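/- A continuum is a compact, connected, metrizable space. Let $X$ be a continuum with basepoint $*$. A regular cover of $X$ by a continuum is a surjective covering map $f_i : X_i \to X$ such that $X_i$ is a continuum and the fibres of $f_i$ are the orbits of a free action of a group $G_i$ of homeomorphisms of $X_i$; choose a basepoint in $X_i$ over $*$. Write $f_i \le f_j$ if there is a continuous surjection $f_{ij} : X_j \to X_i$ with $f_j = f_i \circ f_{ij}$; it is then taken basepoint-preserving, which makes it unique, and it determines a homomorphism $\theta_{ij} : G_j \to G_i$ with $\theta_{ij}(g) \circ f_{ij} = f_{ij} \circ g$. Let $\widehat{X} = \varprojlim X_i$ be the inverse limit over all regular covers of $X$ by continua, let $\widehat{\phi} : \widehat{X} \to X$ be its projection, and let $\pi_P(X) = \varprojlim G_i$, acting on $\widehat{X}$ coordinatewise. Compact Hausdorff spaces carry their unique compatible uniformity. Let $Z$ be a simply connected Poincaré space (connected, locally path connected and semilocally simply connected), and let $f : Z \to X$ be continuous. Then there is a function $f_L : Z \to \widehat{X}$ with $f = \widehat{\phi} \circ f_L$ that is uniformly continuous for the fine uniformity of $Z$ (the finest uniformity whose topology is contained in that of $Z$), and it is unique modulo $\pi_P(X)$: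 the functions $h : Z \to \widehat{X}$ with $f = \widehat{\phi} \circ h$ that are uniformly continuous for the fine uniformity are exactly the functions $g \circ f_L$ with $g \in \pi_P(X)$. These are also exactly the continuous $h$ with $f = \widehat{\phi} \circ h$. Moreover, for every uniformity on $Z$ that is compatible with its topology, has arbitrarily small entourages with connected balls, and makes $f$ uniformly continuous, the functions $g \circ f_L$ with $g \in \pi_P(X)$ are exactly the functions $h : Z \to \widehat{X}$ with $f = \widehat{\phi} \circ h$ that are uniformly continuous for that uniformity. -/

import Mathlib

open Topology Uniformity

universe u v

/-- A cover of `X` by a continuum, with a chosen basepoint over `x₀`: a continuum `Y` (compact,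
connected, metrizable), a surjective covering map `f : Y → X`, and a group of homeomorphisms of `Y`
acting freely, whose orbits are the fibres of `f`, so that `X = Y / G`
(a regular covering map). -/
structure ContinuumCover (X : Type u) [TopologicalSpace X] (x₀ : X) where
  /-- the total space `Y` -/
  carrier : Type u
  [top : TopologicalSpace carrier]
  [compact : CompactSpace carrier]
  [connected : ConnectedSpace carrier]
  [metrizable : TopologicalSpace.MetrizableSpace carrier]
  /-- the covering map `f` -/
  map : carrier → X
  isCoveringMap : IsCoveringMap map
  surjective : Function.Surjective map
  /-- the deck group `G` -/
  deck : Subgroup (carrier ≃ₜ carrier)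
  free : ∀ g ∈ deck, ∀ y, g y = y → g = 1
  fibres_eq_orbits : ∀ y y', map y = map y' ↔ ∃ g ∈ deck, g y = y'
  /-- the basepoint of `Y` -/
  base : carrier
  map_base : map base = x₀

attribute [instance] ContinuumCover.top ContinuumCover.compact ContinuumCover.connected
  ContinuumCover.metrizable

namespace ContinuumCover

variable {X : Type u} [TopologicalSpace X] {x₀ : X}

/-- `h` is the basepoint preserving bonding map `f_ij : X_j → X_i`: a continuous surjection with
`f_j = f_i ∘ f_ij`. (There is at most one, because `X_j` is connected.) One has `f_i ≤ f_j` exactly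
when there is one, for a suitable choice of the basepoint. -/
structure IsBonding (i j : ContinuumCover X x₀) (h : j.carrier → i.carrier) : Prop where
  continuous : Continuous h
  surjective : Function.Surjective h
  comp_eq : i.map ∘ h = j.map
  base_eq : h j.base = i.base

/-- The identity map of a continuum, a cover with trivial deck group. -/
def trivial (X : Type u) [TopologicalSpace X] [CompactSpace X] [ConnectedSpace X]
    [TopologicalSpace.MetrizableSpace X] (x₀ : X) : ContinuumCover X x₀ where
  carrier := X
  map := id
  isCoveringMap := isLocalHomeomorph_iff_isCoveringMap.mp (Homeomorph.refl X).isLocalHomeomorph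
  surjective := Function.surjective_id
  deck := ⊥
  free g hg _ _ := by simpa using hg
  fibres_eq_orbits y y' := by simp
  base := x₀
  map_base := rfl

end ContinuumCover

/-- The compact universal cover `X̂`: the inverse limit of all covers of `X` by continua, with the
basepoint preserving bonding maps. (Equivalent pointed covers are linked by mutually inverse
bonding maps, so letting the index run over all pointed covers gives the same limit as keeping one
from each equivalence class.) -/
def CompactUniversalCover (X : Type u) [TopologicalSpace X] (x₀ : X) : Type (u + 1) :=
  {x : (i : ContinuumCover X x₀) → i.carrier //
    ∀ (i j : ContinuumCover X x₀) (h : j.carrier → i.carrier), i.IsBonding j h → h (x j) = x i}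

/-- The profinite fundamental group `π_P(X)`: the inverse limit of the deck groups `G_i`, along the
homomorphisms `θ_ij : G_j → G_i` determined by `θ_ij g ∘ f_ij = f_ij ∘ g`. -/
def ProfiniteFundamentalGroup (X : Type u) [TopologicalSpace X] (x₀ : X) :
    Subgroup ((i : ContinuumCover X x₀) → i.deck) where
  carrier := {g | ∀ (i j : ContinuumCover X x₀) (h : j.carrier → i.carrier), i.IsBonding j h →
    ∀ y, (g i : i.carrier ≃ₜ i.carrier) (h y) = h ((g j : j.carrier ≃ₜ j.carrier) y)}
  one_mem' i j h _ y := rfl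
  mul_mem' {a b} ha hb i j h hh y := by
    change (a i : i.carrier ≃ₜ i.carrier) ((b i : i.carrier ≃ₜ i.carrier) (h y)) =
      h ((a j : j.carrier ≃ₜ j.carrier) ((b j : j.carrier ≃ₜ j.carrier) y))
    rw [hb i j h hh, ha i j h hh]
  inv_mem' {a} ha i j h hh y := by
    change (a i : i.carrier ≃ₜ i.carrier).symm (h y) =
      h ((a j : j.carrier ≃ₜ j.carrier).symm y)
    rw [Homeomorph.symm_apply_eq, ha i j h hh, Homeomorph.apply_symm_apply]

namespace CompactUniversalCover

variable {X : Type u} [TopologicalSpace X] {x₀ : X}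

/-- The inverse limit topology. -/
instance : TopologicalSpace (CompactUniversalCover X x₀) :=
  inferInstanceAs (TopologicalSpace (Subtype _))

instance : T2Space (CompactUniversalCover X x₀) :=
  inferInstanceAs (T2Space (Subtype _))

instance : CompactSpace (CompactUniversalCover X x₀) := by
  have h : IsClosed {x : (i : ContinuumCover X x₀) → i.carrier |
      ∀ (i j : ContinuumCover X x₀) (h : j.carrier → i.carrier), i.IsBonding j h →
        h (x j) = x i} := by
    simp only [Set.ofPred_forall]
    exact isClosed_iInter fun i => isClosed_iInter fun j => isClosed_iInter fun h =>
      isClosed_iInter fun hh =>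
        isClosed_eq (hh.continuous.comp (continuous_apply j)) (continuous_apply i)
  exact isCompact_iff_compactSpace.mp h.isCompact

/-- The action of `π_P(X) = lim G_i` on `X̂ = lim X_i`, coordinate by coordinate. -/
instance : MulAction (ProfiniteFundamentalGroup X x₀) (CompactUniversalCover X x₀) where
  smul g x := ⟨fun i => (g.1 i : i.carrier ≃ₜ i.carrier) (x.1 i), fun i j h hh => by
    rw [← g.2 i j h hh, x.2 i j h hh]⟩
  one_smul _ := rfl
  mul_smul _ _ _ := rfl

/-- The projection `φ̂ : X̂ → X` of the inverse limit onto its coordinate at the identity cover of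
`X`. -/
def proj [CompactSpace X] [ConnectedSpace X] [TopologicalSpace.MetrizableSpace X]
    (x : CompactUniversalCover X x₀) : X :=
  x.1 (ContinuumCover.trivial X x₀)

end CompactUniversalCover

/-- The only uniformity of a compact Hausdorff space compatible with its topology. -/
abbrev compactUniformity (K : Type*) [TopologicalSpace K] [CompactSpace K] [T2Space K] :
    UniformSpace K :=
  uniformSpaceOfCompactR1

/-- The fine uniformity of a topological space: the finest uniformity whose topology is contained
in the given one. -/
abbrev fineUniformity (Z : Type*) [t : TopologicalSpace Z] : UniformSpace Z :=
  sInf {w : UniformSpace Z | t ≤ w.toTopologicalSpace}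

/-- A uniformity is uniformly locally connected when there are arbitrarily small entourages whose
balls are connected. -/
def IsUniformlyLocallyConnected {Z : Type*} (w : UniformSpace Z) : Prop :=
  ∀ V ∈ 𝓤[w], ∃ W ∈ 𝓤[w], W ⊆ V ∧
    ∀ z, IsConnected (UniformSpace.ball z W)

/-- A Poincaré space: connected, locally path connected and semilocally simply connected. -/
structure IsPoincareSpace (Z : Type*) [TopologicalSpace Z] : Prop where
  connected : ConnectedSpace Z
  locallyPathConnected : LocallyPathConnectedSpace Z
  semilocallySimplyConnected : ∀ z : Z, ∃ U ∈ 𝓝 z, ∀ p : Path z z,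
    (∀ t, p t ∈ U) → p.Homotopic (Path.refl z)

/-! Since `Z` is simply connected and locally path connected, `f` lifts to every cover, uniquely
once the value at one point is prescribed. Prescribing the coordinates of a single point of `X̂`
makes these lifts compatible, so they form a lift to `X̂` (`exists_lift`). Such a point exists over
`f z₀` by compactness, because the covers are directed: the base component of a fibre product is
again a cover (`join`, `proj_surjective`). Fibres of the projection are orbits of `π_P(X)`
(`exists_smul_eq`), so unique lifting makes the continuous lifts one orbit.

It remains to see that continuous lifts are the uniformly continuous ones. For the fine uniformity
this holds for every map to a compact Hausdorff space. For a uniformly locally connected uniformity,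
covers by continua have finite fibres, so a connected set with small image is small
(`exists_entourage_of_finite_fibers`); applied to images of connected balls, this transfers uniform
continuity from `f` to each coordinate of the lift. -/

/-! ### Local homeomorphisms from compact spaces -/

theorem IsLocalHomeomorph.prodMap {A B C D : Type*} [TopologicalSpace A] [TopologicalSpace B]
    [TopologicalSpace C] [TopologicalSpace D] {f : A → B} {g : C → D}
    (hf : IsLocalHomeomorph f) (hg : IsLocalHomeomorph g) :
    IsLocalHomeomorph (Prod.map f g) := by
  rintro ⟨a, c⟩
  obtain ⟨e, he, rfl⟩ := hf a
  obtain ⟨e', he', rfl⟩ := hg c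
  exact ⟨e.prod e', ⟨he, he'⟩, rfl⟩

theorem Continuous.surjective_of_isOpenMap {E X : Type*} [TopologicalSpace E] [TopologicalSpace X]
    [CompactSpace E] [Nonempty E] [ConnectedSpace X] [T2Space X] {p : E → X}
    (hc : Continuous p) (ho : IsOpenMap p) : Function.Surjective p := by
  rw [← Set.range_eq_univ]
  exact IsClopen.eq_univ ⟨(isCompact_range hc).isClosed, ho.isOpen_range⟩ (Set.range_nonempty p)

/-- A local homeomorphism from a compact space to a `T1` space has finite fibres. -/
theorem IsLocalHomeomorph.finite_fiber {E X : Type*} [TopologicalSpace E]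
    [TopologicalSpace X] [CompactSpace E] [T1Space X] {p : E → X} (hp : IsLocalHomeomorph p)
    (x : X) : (p ⁻¹' {x}).Finite := by
  refine (isClosed_singleton.preimage hp.continuous).isCompact.finite ?_
  exact IsDiscrete.of_openPartialHomeomorph p (x := x) subset_rfl fun e _ => by
    obtain ⟨φ, h, h'⟩ := hp e
    exact ⟨φ, h, h'.symm⟩

/-- The components of a compact Hausdorff space that is locally homeomorphic over a connected
Hausdorff space are open: every nonempty clopen set meets each of the finite fibres. -/
theorem IsLocalHomeomorph.isOpen_connectedComponent {E X : Type*} [TopologicalSpace E]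
    [TopologicalSpace X] [CompactSpace E] [T2Space E] [ConnectedSpace X] [T2Space X] {p : E → X}
    (hp : IsLocalHomeomorph p) (b : E) : IsOpen (connectedComponent b) := by
  have key : ∀ W : Set E, IsClopen W → W.Nonempty → ∃ y ∈ W, p y = p b := by
    intro W hW hne
    have : p '' W = Set.univ := IsClopen.eq_univ
      ⟨(hW.1.isCompact.image hp.continuous).isClosed, hp.isOpenMap _ hW.2⟩ (hne.image p)
    obtain ⟨y, hy, h⟩ := this.symm ▸ Set.mem_univ (p b)
    exact ⟨y, hy, h⟩
  -- Only the finitely many points of the fibre of `p b` need separating from `b`, so the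
  -- intersection `W` of these sets is still clopen.
  have sep : ∀ y, ∃ U : Set E, IsClopen U ∧ b ∈ U ∧ (y ∈ U → y ∈ connectedComponent b) := by
    intro y
    by_cases hy : y ∈ connectedComponent b
    · exact ⟨Set.univ, isClopen_univ, trivial, fun _ => hy⟩
    · rw [connectedComponent_eq_iInter_isClopen, Set.mem_iInter] at hy
      push Not at hy
      obtain ⟨⟨U, hU, hb⟩, hyU⟩ := hy
      exact ⟨U, hU, hb, fun h => absurd h hyU⟩
  choose U hU hbU hyU using sep
  set W : Set E := ⋂ y ∈ p ⁻¹' {p b}, U y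
  have hW : IsClopen W := (hp.finite_fiber (p b)).isClopen_biInter fun y _ => hU y
  have hbW : b ∈ W := Set.mem_iInter₂.mpr fun y _ => hbU y
  have hWC : W ⊆ connectedComponent b := by
    rw [connectedComponent_eq_iInter_isClopen]
    refine Set.subset_iInter fun ⟨V, hV, hbV⟩ => ?_
    by_contra hWV
    obtain ⟨y, hy, hyb⟩ := key (W \ V) (hW.diff hV) (Set.sdiff_nonempty.mpr hWV)
    have := hyU y (Set.mem_iInter₂.mp hy.1 y hyb)
    exact hy.2 (hV.connectedComponent_subset hbV this)
  rw [hWC.antisymm' (hW.connectedComponent_subset hbW)]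
  exact hW.2

/-! ### Uniform continuity of lifts -/

/-- Connected sets with small image under a finite-to-one map of compact Hausdorff spaces
are small. -/
theorem exists_entourage_of_finite_fibers {E X : Type*} [UniformSpace E] [UniformSpace X]
    [CompactSpace E] [T2Space E] [CompactSpace X] [T2Space X] {p : E → X} (hp : Continuous p)
    (fin : ∀ x, (p ⁻¹' {x}).Finite) {D : Set (E × E)} (hD : D ∈ 𝓤 E) :
    ∃ V ∈ 𝓤 X, ∀ A : Set E, IsPreconnected A →
      ∀ x, p '' A ⊆ UniformSpace.ball x V → A ×ˢ A ⊆ D := by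
  have loc : ∀ x, ∃ U : Set X, IsOpen U ∧ x ∈ U ∧
      ∀ A : Set E, IsPreconnected A → p '' A ⊆ U → A ×ˢ A ⊆ D := by
    intro x
    obtain ⟨S, hS, hdisj⟩ := (fin x).t2_separation
    obtain ⟨D', hD', hsymm, hDD⟩ := comp_symm_mem_uniformity_sets hD
    set T : E → Set E := fun y => S y ∩ interior (UniformSpace.ball y D')
    have hT : ∀ y, IsOpen (T y) := fun y => (hS y).2.inter isOpen_interior
    have hyT : ∀ y, y ∈ T y := fun y =>
      ⟨(hS y).1, mem_interior_iff_mem_nhds.mpr (UniformSpace.ball_mem_nhds y hD')⟩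
    have hTD : ∀ y, T y ×ˢ T y ⊆ D := by
      rintro y ⟨a, b⟩ ⟨ha, hb⟩
      have ha' : a ∈ UniformSpace.ball y D' := interior_subset ha.2
      have hb' : b ∈ UniformSpace.ball y D' := interior_subset hb.2
      exact hDD ⟨y, UniformSpace.mem_ball_symmetry.mp ha', hb'⟩
    set O : Set E := ⋃ y ∈ p ⁻¹' {x}, T y
    have hO : IsOpen O := isOpen_biUnion fun y _ => hT y
    -- The points whose whole fibre lies in `O`; this set is open because `p` is closed.
    refine ⟨(p '' Oᶜ)ᶜ, (hp.isClosedMap _ hO.isClosed_compl).isOpen_compl, ?_, ?_⟩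
    · rintro ⟨y, hy, hyx⟩
      exact hy (Set.mem_biUnion (show y ∈ p ⁻¹' {x} from hyx) (hyT y))
    · intro A hA hAU
      have hAO : A ⊆ O := fun a ha => by
        by_contra h
        exact hAU ⟨a, ha, rfl⟩ ⟨a, h, rfl⟩
      rcases A.eq_empty_or_nonempty with rfl | ⟨a, ha⟩
      · simp
      obtain ⟨y, hy, hay⟩ := Set.mem_iUnion₂.mp (hAO ha)
      -- `T y` and `R` are disjoint and open and cover `A`, so the connected set `A` stays in `T y`.
      set R : Set E := ⋃ y' ∈ p ⁻¹' {x} \ {y}, T y'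
      have hR : IsOpen R := isOpen_biUnion fun y _ => hT y
      have hdis : Disjoint (T y) R := by
        refine Set.disjoint_iUnion₂_right.mpr fun y' hy' => ?_
        exact (hdisj hy hy'.1 (Ne.symm hy'.2)).mono Set.inter_subset_left Set.inter_subset_left
      have hcov : A ⊆ T y ∪ R := fun a ha => by
        obtain ⟨y', hy', h⟩ := Set.mem_iUnion₂.mp (hAO ha)
        by_cases he : y' = y
        · exact Or.inl (he ▸ h)
        · exact Or.inr (Set.mem_biUnion (show y' ∈ p ⁻¹' {x} \ {y} from ⟨hy', he⟩) h)
      have : A ⊆ T y := hA.subset_left_of_subset_union (hT y) hR hdis hcov ⟨a, ha, hay⟩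
      exact (Set.prod_mono this this).trans (hTD y)
  choose U hU hxU hUA using loc
  obtain ⟨V, hV, h⟩ := lebesgue_number_lemma isCompact_univ hU
    fun x _ => Set.mem_iUnion.mpr ⟨x, hxU x⟩
  refine ⟨V, hV, fun A hA x hAx => ?_⟩
  obtain ⟨i, hi⟩ := h x trivial
  exact hUA i A hA (hAx.trans hi)

/-- A continuous lift through a finite-to-one map of compact Hausdorff spaces is uniformly
continuous for every uniformly locally connected uniformity making the map below so. -/
theorem IsUniformlyLocallyConnected.uniformContinuous_lift {Z E X : Type*} [w : UniformSpace Z]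
    (hw : IsUniformlyLocallyConnected w) [UniformSpace E] [UniformSpace X]
    [CompactSpace E] [T2Space E] [CompactSpace X] [T2Space X] {p : E → X} (hp : Continuous p)
    (fin : ∀ x, (p ⁻¹' {x}).Finite) {h : Z → E} (hh : Continuous h)
    (hu : UniformContinuous (p ∘ h)) : UniformContinuous h := by
  intro D hD
  obtain ⟨V, hV, hVA⟩ := exists_entourage_of_finite_fibers hp fin hD
  obtain ⟨W, hW, hWV, hWc⟩ := hw _ (hu hV)
  refine Filter.mem_map.mpr (Filter.mem_of_superset hW ?_)
  rintro ⟨a, b⟩ hab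
  refine hVA (h '' UniformSpace.ball a W) ((hWc a).isPreconnected.image h hh.continuousOn)
    (p (h a)) ?_ ⟨⟨a, ?_, rfl⟩, ⟨b, hab, rfl⟩⟩
  · rintro _ ⟨_, ⟨c, hc, rfl⟩, rfl⟩
    exact hWV hc
  · exact refl_mem_uniformity hW

/-- The pullback along a continuous `h` of the uniformity of `K` is one of the uniformities whose
infimum is the fine one. Conversely, the fine uniformity induces a topology contained in that of
`Z`. -/
theorem uniformContinuous_fineUniformity_iff {Z K : Type*} [TopologicalSpace Z]
    [TopologicalSpace K] [CompactSpace K] [T2Space K] {h : Z → K} :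
    UniformContinuous[fineUniformity Z, compactUniformity K] h ↔ Continuous h := by
  constructor
  · intro hu
    have hc := @UniformContinuous.continuous Z K (fineUniformity Z) (compactUniformity K) h hu
    refine continuous_le_dom ?_ hc
    rw [UniformSpace.toTopologicalSpace_sInf]
    exact le_iInf₂ fun w hw => hw
  · intro hc
    rw [uniformContinuous_iff_le_comap]
    exact sInf_le (continuous_iff_le_induced.mp hc)

/-! ### Bonding maps between covers -/

namespace ContinuumCover

variable {X : Type u} [TopologicalSpace X] {x₀ : X}

theorem IsBonding.comp {i j k : ContinuumCover X x₀} {h : j.carrier → i.carrier}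
    {h' : k.carrier → j.carrier} (hh : i.IsBonding j h) (hh' : j.IsBonding k h') :
    i.IsBonding k (h ∘ h') where
  continuous := hh.continuous.comp hh'.continuous
  surjective := hh.surjective.comp hh'.surjective
  comp_eq := by rw [← Function.comp_assoc, hh.comp_eq, hh'.comp_eq]
  base_eq := by rw [Function.comp_apply, hh'.base_eq, hh.base_eq]

theorem IsBonding.unique {i j : ContinuumCover X x₀} {h h' : j.carrier → i.carrier}
    (hh : i.IsBonding j h) (hh' : i.IsBonding j h') : h = h' :=
  i.isCoveringMap.eq_of_comp_eq hh.continuous hh'.continuous (hh.comp_eq.trans hh'.comp_eq.symm)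
    j.base (hh.base_eq.trans hh'.base_eq.symm)

theorem IsBonding.map_apply {i j : ContinuumCover X x₀} {h : j.carrier → i.carrier}
    (hh : i.IsBonding j h) (y : j.carrier) : i.map (h y) = j.map y :=
  congrFun hh.comp_eq y

/-- Surjectivity of a bonding map is automatic. -/
theorem isBonding_of_continuous {i j : ContinuumCover X x₀} {h : j.carrier → i.carrier}
    (hc : Continuous h) (he : i.map ∘ h = j.map) (hb : h j.base = i.base) : i.IsBonding j h where
  continuous := hc
  surjective := hc.surjective_of_isOpenMap
    (IsLocalHomeomorph.of_comp (he ▸ j.isCoveringMap.isLocalHomeomorph)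
      i.isCoveringMap.isLocalHomeomorph hc).isOpenMap
  comp_eq := he
  base_eq := hb

theorem map_deck (i : ContinuumCover X x₀) {g : i.carrier ≃ₜ i.carrier} (hg : g ∈ i.deck)
    (y : i.carrier) : i.map (g y) = i.map y :=
  ((i.fibres_eq_orbits y (g y)).mpr ⟨g, hg, rfl⟩).symm

theorem isBonding_trivial [CompactSpace X] [ConnectedSpace X]
    [TopologicalSpace.MetrizableSpace X] (i : ContinuumCover X x₀) :
    (trivial X x₀).IsBonding i i.map where
  continuous := i.isCoveringMap.continuous
  surjective := i.surjective
  comp_eq := rfl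
  base_eq := i.map_base

/-! ### Directedness of the covers, via fibre products -/

section Join

variable (i j : ContinuumCover X x₀)

/-- The fibre product of two covers. -/
abbrev FibreProduct : Type u :=
  Prod.map i.map j.map ⁻¹' Set.diagonal X

/-- The basepoint of the fibre product. -/
def FibreProduct.base : FibreProduct i j :=
  ⟨(i.base, j.base), i.map_base.trans j.map_base.symm⟩

/-- The projection of the fibre product onto `X`. -/
def FibreProduct.toX (p : FibreProduct i j) : X := i.map p.1.1

instance [T2Space X] : CompactSpace (FibreProduct i j) :=
  isCompact_iff_compactSpace.mp <| IsClosed.isCompact <|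
    isClosed_diagonal.preimage (i.isCoveringMap.continuous.prodMap j.isCoveringMap.continuous)

theorem FibreProduct.isLocalHomeomorph_toX [T2Space X] :
    IsLocalHomeomorph (FibreProduct.toX i j) := by
  have h : IsLocalHomeomorph (Prod.map i.map j.map) :=
    i.isCoveringMap.isLocalHomeomorph.prodMap j.isCoveringMap.isLocalHomeomorph
  -- The source is compact Hausdorff, so the local homeomorphism is a covering map, and covering
  -- maps restrict to preimages.
  have h' := ((isLocalHomeomorph_iff_isCoveringMap.mp h).restrictPreimage
    (Set.diagonal X)).isLocalHomeomorph
  let e : Set.diagonal X ≃ₜ X :=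
    { toFun := fun q => q.1.1
      invFun := fun x => ⟨(x, x), rfl⟩
      left_inv := fun ⟨⟨a, b⟩, hab⟩ => Subtype.ext (Prod.ext rfl hab)
      right_inv := fun _ => rfl
      continuous_toFun := by fun_prop
      continuous_invFun := by fun_prop }
  exact e.isLocalHomeomorph.comp h'

/-- The homeomorphism of the fibre product given by a pair of deck transformations. -/
def FibreProduct.deckMap {a : i.carrier ≃ₜ i.carrier} {b : j.carrier ≃ₜ j.carrier}
    (ha : a ∈ i.deck) (hb : b ∈ j.deck) : FibreProduct i j ≃ₜ FibreProduct i j :=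
  (a.prodCongr b).subtype fun p => by
    change i.map p.1 = j.map p.2 ↔ i.map (a p.1) = j.map (b p.2)
    rw [i.map_deck ha, j.map_deck hb]

/-- The component of the basepoint in the fibre product. -/
abbrev JoinCarrier : Type u := connectedComponent (FibreProduct.base i j)

/-- The deck group of the component of the basepoint in the fibre product. -/
def joinDeck : Subgroup (JoinCarrier i j ≃ₜ JoinCarrier i j) where
  carrier := {g | ∃ a ∈ i.deck, ∃ b ∈ j.deck, ∀ c, (g c).1.1 = (a c.1.1.1, b c.1.1.2)}
  one_mem' := ⟨1, one_mem _, 1, one_mem _, fun _ => rfl⟩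
  mul_mem' := by
    rintro g g' ⟨a, ha, b, hb, h⟩ ⟨a', ha', b', hb', h'⟩
    refine ⟨a * a', mul_mem ha ha', b * b', mul_mem hb hb', fun c => ?_⟩
    change (g (g' c)).1.1 = (a (a' c.1.1.1), b (b' c.1.1.2))
    rw [h, h']
  inv_mem' := by
    rintro g ⟨a, ha, b, hb, h⟩
    refine ⟨a⁻¹, inv_mem ha, b⁻¹, inv_mem hb, fun c => ?_⟩
    change (g.symm c).1.1 = (a.symm c.1.1.1, b.symm c.1.1.2)
    obtain ⟨d, rfl⟩ := g.surjective c
    rw [g.symm_apply_apply, h]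
    simp

theorem exists_joinDeck_apply_eq (c c' : JoinCarrier i j)
    (h : i.map c.1.1.1 = i.map c'.1.1.1) : ∃ g ∈ joinDeck i j, g c = c' := by
  obtain ⟨a, ha, hac⟩ := (i.fibres_eq_orbits _ _).mp h
  have h2 : j.map c.1.1.2 = j.map c'.1.1.2 :=
    (show i.map c.1.1.1 = j.map c.1.1.2 from c.1.2).symm.trans
      (h.trans (show i.map c'.1.1.1 = j.map c'.1.1.2 from c'.1.2))
  obtain ⟨b, hb, hbc⟩ := (j.fibres_eq_orbits _ _).mp h2
  let e := FibreProduct.deckMap i j ha hb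
  have hec : e c.1 = c'.1 := Subtype.ext (Prod.ext hac hbc)
  -- `e` carries the component of `c` onto that of `c'`; both are the base component, so `e`
  -- restricts to it.
  have key : ∀ p, p ∈ connectedComponent (FibreProduct.base i j) ↔
      e p ∈ connectedComponent (FibreProduct.base i j) := by
    intro p
    constructor
    · intro hp
      rw [connectedComponent_eq c.2] at hp
      rw [connectedComponent_eq c'.2, ← hec]
      exact e.continuous.image_connectedComponent_subset c.1 ⟨p, hp, rfl⟩
    · intro hp
      rw [connectedComponent_eq c'.2] at hp
      rw [connectedComponent_eq c.2, ← e.symm_apply_apply c.1, hec, ← e.symm_apply_apply p]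
      exact e.symm.continuous.image_connectedComponent_subset c'.1 ⟨e p, hp, rfl⟩
  refine ⟨e.subtype key, ⟨a, ha, b, hb, fun _ => rfl⟩, Subtype.ext hec⟩

instance [T2Space X] : CompactSpace (JoinCarrier i j) :=
  isCompact_iff_compactSpace.mp isClosed_connectedComponent.isCompact

theorem isLocalHomeomorph_joinCarrier [ConnectedSpace X] [T2Space X] :
    IsLocalHomeomorph fun c : JoinCarrier i j => i.map c.1.1.1 :=
  (FibreProduct.isLocalHomeomorph_toX i j).comp
    ((FibreProduct.isLocalHomeomorph_toX i j).isOpen_connectedComponent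
      _).isOpenEmbedding_subtypeVal.isLocalHomeomorph

/-- The join of two covers: the component of the basepoint in their fibre product. -/
def join [ConnectedSpace X] [T2Space X] : ContinuumCover X x₀ where
  carrier := JoinCarrier i j
  connected := isConnected_iff_connectedSpace.mp isConnected_connectedComponent
  map c := i.map c.1.1.1
  isCoveringMap := isLocalHomeomorph_iff_isCoveringMap.mp (isLocalHomeomorph_joinCarrier i j)
  surjective :=
    have : Nonempty (JoinCarrier i j) := ⟨⟨_, mem_connectedComponent⟩⟩
    (isLocalHomeomorph_joinCarrier i j).continuous.surjective_of_isOpenMap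
      (isLocalHomeomorph_joinCarrier i j).isOpenMap
  deck := joinDeck i j
  free := by
    rintro g ⟨a, ha, b, hb, h⟩ c hc
    have hc' := h c
    rw [hc] at hc'
    have ha1 := i.free a ha _ (congrArg Prod.fst hc').symm
    have hb1 := j.free b hb _ (congrArg Prod.snd hc').symm
    subst ha1 hb1
    exact Homeomorph.ext fun d => Subtype.ext (Subtype.ext (h d))
  fibres_eq_orbits c c' := by
    refine ⟨exists_joinDeck_apply_eq i j c c', ?_⟩
    rintro ⟨g, ⟨a, ha, b, hb, h⟩, rfl⟩
    rw [h]
    exact (i.map_deck ha _).symm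
  base := ⟨FibreProduct.base i j, mem_connectedComponent⟩
  map_base := i.map_base

theorem exists_isBonding_isBonding [ConnectedSpace X] [T2Space X] :
    ∃ k : ContinuumCover X x₀, (∃ h, i.IsBonding k h) ∧ ∃ h, j.IsBonding k h := by
  refine ⟨join i j, ⟨fun c => c.1.1.1, isBonding_of_continuous ?_ rfl rfl⟩,
    ⟨fun c => c.1.1.2, isBonding_of_continuous ?_ ?_ rfl⟩⟩
  · exact continuous_fst.comp (continuous_subtype_val.comp continuous_subtype_val)
  · exact continuous_snd.comp (continuous_subtype_val.comp continuous_subtype_val)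
  · funext c
    exact (show i.map c.1.1.1 = j.map c.1.1.2 from c.1.2).symm

end Join

end ContinuumCover

/-! ### The inverse limit and lifting to it -/

namespace CompactUniversalCover

variable {X : Type u} [TopologicalSpace X] {x₀ : X}

theorem continuous_coord (i : ContinuumCover X x₀) :
    Continuous fun x : CompactUniversalCover X x₀ => x.1 i :=
  (continuous_apply i).comp continuous_subtype_val

theorem continuous_smul_left (g : ProfiniteFundamentalGroup X x₀) :
    Continuous fun x : CompactUniversalCover X x₀ => g • x :=
  Continuous.subtype_mk (continuous_pi fun i =>
    (g.1 i : i.carrier ≃ₜ i.carrier).continuous.comp (continuous_coord i)) _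

/-- A map to the compact universal cover is uniformly continuous once its coordinates are. -/
theorem uniformContinuous_of_coord {Z : Type v} (w : UniformSpace Z) {h : Z → CompactUniversalCover X x₀}
    (hh : ∀ i : ContinuumCover X x₀,
      UniformContinuous[w, compactUniformity i.carrier] fun z => (h z).1 i) :
    UniformContinuous[w, compactUniformity (CompactUniversalCover X x₀)] h := by
  let (i : ContinuumCover X x₀) : UniformSpace i.carrier := compactUniformity i.carrier
  let u : UniformSpace (CompactUniversalCover X x₀) :=
    UniformSpace.comap Subtype.val (Pi.uniformSpace _)
  -- A compact Hausdorff topology has one compatible uniformity, so uniform continuity can be tested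
  -- coordinatewise.
  have hu : compactUniformity (CompactUniversalCover X x₀) = u :=
    unique_uniformity_of_compact rfl rfl
  rw [hu]
  exact uniformContinuous_comap' (uniformContinuous_pi.mpr hh)

variable [CompactSpace X] [ConnectedSpace X] [TopologicalSpace.MetrizableSpace X]

theorem map_coord (x : CompactUniversalCover X x₀) (i : ContinuumCover X x₀) :
    i.map (x.1 i) = proj x :=
  x.2 _ i _ i.isBonding_trivial

theorem proj_surjective : Function.Surjective (proj : CompactUniversalCover X x₀ → X) := by
  intro x
  -- `S k` imposes only the conditions on bonding maps out of `k`. The intersection of all `S k` is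
  -- the fibre over `x`, and these closed sets shrink as `k` grows.
  let S : ContinuumCover X x₀ → Set ((i : ContinuumCover X x₀) → i.carrier) := fun k =>
    {y | k.map (y k) = x ∧ ∀ (i : ContinuumCover X x₀) (h : k.carrier → i.carrier),
      i.IsBonding k h → h (y k) = y i}
  have hcl : ∀ k, IsClosed (S k) := by
    intro k
    have : S k = {y | k.map (y k) = x} ∩ ⋂ (i : ContinuumCover X x₀)
        (h : k.carrier → i.carrier) (_ : i.IsBonding k h), {y | h (y k) = y i} := by
      ext y
      simp [S]
    rw [this]
    refine (isClosed_eq (k.isCoveringMap.continuous.comp (continuous_apply k))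
      continuous_const).inter ?_
    exact isClosed_iInter fun i => isClosed_iInter fun h => isClosed_iInter fun hh =>
      isClosed_eq (hh.continuous.comp (continuous_apply k)) (continuous_apply i)
  have hne : ∀ k, (S k).Nonempty := by
    intro k
    obtain ⟨z, hz⟩ := k.surjective x
    classical
    -- Coordinates not below `k` are unconstrained in `S k`; the basepoint is an arbitrary value
    -- there.
    let y : (i : ContinuumCover X x₀) → i.carrier := fun i =>
      if h : ∃ h, i.IsBonding k h then h.choose z else i.base
    have hy : ∀ (i : ContinuumCover X x₀) (h : k.carrier → i.carrier),
        i.IsBonding k h → y i = h z := by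
      intro i h hh
      have he : ∃ h, i.IsBonding k h := ⟨h, hh⟩
      simp only [y, dif_pos he]
      rw [he.choose_spec.unique hh]
    have hid : k.IsBonding k id := ⟨continuous_id, Function.surjective_id, rfl, rfl⟩
    have hk : y k = z := hy k id hid
    exact ⟨y, by rw [hk, hz], fun i h hh => by rw [hk, hy i h hh]⟩
  have hmono : ∀ (k l : ContinuumCover X x₀) m, k.IsBonding l m → S l ⊆ S k := by
    intro k l m hm y hy
    have hk : m (y l) = y k := hy.2 k m hm
    refine ⟨?_, fun i h hh => ?_⟩
    · rw [← hk, hm.map_apply, hy.1]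
    · rw [← hk]
      exact hy.2 i _ (hh.comp hm)
  have hdir : Directed (· ⊇ ·) S := by
    intro i j
    obtain ⟨k, ⟨h, hh⟩, ⟨h', hh'⟩⟩ := i.exists_isBonding_isBonding j
    exact ⟨k, hmono i k h hh, hmono j k h' hh'⟩
  have : Nonempty (ContinuumCover X x₀) := ⟨ContinuumCover.trivial X x₀⟩
  obtain ⟨y, hy⟩ := IsCompact.nonempty_iInter_of_directed_nonempty_isCompact_isClosed S hdir hne
    (fun k => (hcl k).isCompact) hcl
  rw [Set.mem_iInter] at hy
  exact ⟨⟨y, fun i j h hh => (hy j).2 i h hh⟩, (hy (ContinuumCover.trivial X x₀)).1⟩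

theorem proj_smul (g : ProfiniteFundamentalGroup X x₀) (x : CompactUniversalCover X x₀) :
    proj (g • x) = proj x :=
  (ContinuumCover.trivial X x₀).map_deck (g.1 _).2 (x.1 _)

/-- `π_P(X)` acts transitively on the fibres of the projection. -/
theorem exists_smul_eq {x y : CompactUniversalCover X x₀} (h : proj x = proj y) :
    ∃ g : ProfiniteFundamentalGroup X x₀, g • x = y := by
  have hi : ∀ i : ContinuumCover X x₀, ∃ g ∈ i.deck, g (x.1 i) = y.1 i := fun i =>
    (i.fibres_eq_orbits _ _).mp (by rw [map_coord, map_coord, h])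
  choose g hg hgx using hi
  refine ⟨⟨fun i => ⟨g i, hg i⟩, fun i j b hb => ?_⟩, Subtype.ext (funext hgx)⟩
  -- Compatibility of the `g i`: `g i ∘ b` and `b ∘ g j` both lift `j.map` through `i.map`, and they
  -- agree at `x.1 j`.
  refine congrFun (i.isCoveringMap.eq_of_comp_eq ((g i).continuous.comp hb.continuous)
    (hb.continuous.comp (g j).continuous) ?_ (x.1 j) ?_)
  · funext y
    simp only [Function.comp_apply]
    rw [i.map_deck (hg i), hb.map_apply, hb.map_apply, j.map_deck (hg j)]
  · change g i (b (x.1 j)) = b (g j (x.1 j))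
    rw [x.2 i j b hb, hgx, hgx, y.2 i j b hb]

variable {Z : Type v} [TopologicalSpace Z]

theorem lift_unique [PreconnectedSpace Z] {h h' : Z → CompactUniversalCover X x₀}
    (hc : Continuous h) (hc' : Continuous h') (he : proj ∘ h = proj ∘ h') (z : Z)
    (hz : h z = h' z) : h = h' := by
  have key : ∀ i : ContinuumCover X x₀, (fun z => (h z).1 i) = fun z => (h' z).1 i := by
    intro i
    refine i.isCoveringMap.eq_of_comp_eq ((continuous_coord i).comp hc)
      ((continuous_coord i).comp hc') ?_ z (by rw [hz])
    funext z
    simp only [Function.comp_apply, map_coord]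
    exact congrFun he z
  exact funext fun z => Subtype.ext (funext fun i => congrFun (key i) z)

theorem exists_lift [SimplyConnectedSpace Z] [LocallyPathConnectedSpace Z] {f : Z → X}
    (hf : Continuous f) :
    ∃ fL : Z → CompactUniversalCover X x₀, Continuous fL ∧ proj ∘ fL = f := by
  obtain ⟨z₀⟩ : Nonempty Z := inferInstance
  obtain ⟨x, hx⟩ := proj_surjective (x₀ := x₀) (f z₀)
  have hex : ∀ i : ContinuumCover X x₀, ∃ F : C(Z, i.carrier), F z₀ = x.1 i ∧ i.map ∘ F = f :=
    fun i => (i.isCoveringMap.existsUnique_continuousMap_lifts ⟨f, hf⟩ z₀ (x.1 i)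
      (by rw [map_coord, hx]; rfl)).exists
  choose F hF0 hF using hex
  refine ⟨fun z => ⟨fun i => F i z, fun i j b hb => ?_⟩,
    Continuous.subtype_mk (continuous_pi fun i => (F i).continuous) _,
    hF (ContinuumCover.trivial X x₀)⟩
  -- Both `b ∘ F j` and `F i` lift `f`, and they agree at `z₀` because `x` lies in the limit.
  refine congrFun (i.isCoveringMap.eq_of_comp_eq (g₁ := b ∘ F j)
    (hb.continuous.comp (F j).continuous) (F i).continuous ?_ z₀ ?_) z
  · rw [hF, ← Function.comp_assoc, hb.comp_eq, hF]
  · rw [Function.comp_apply, hF0, hF0, x.2 i j b hb]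

/-- Continuous lifts of one map differ by elements of `π_P(X)`. -/
theorem setOf_continuous_lift_eq [ConnectedSpace Z] {f : Z → X}
    {fL : Z → CompactUniversalCover X x₀} (hc : Continuous fL) (hL : proj ∘ fL = f) :
    {h : Z → CompactUniversalCover X x₀ | Continuous h ∧ proj ∘ h = f} =
      {h | ∃ g : ProfiniteFundamentalGroup X x₀, h = fun z => g • fL z} := by
  have hsmul : ∀ g : ProfiniteFundamentalGroup X x₀,
      Continuous (fun z => g • fL z) ∧ proj ∘ (fun z => g • fL z) = f := fun g =>
    ⟨(continuous_smul_left g).comp hc, by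
      rw [← hL]
      exact funext fun z => proj_smul g (fL z)⟩
  ext h
  constructor
  · rintro ⟨hh, hhf⟩
    obtain ⟨z₀⟩ : Nonempty Z := inferInstance
    obtain ⟨g, hg⟩ := exists_smul_eq (x := fL z₀) (y := h z₀)
      ((congrFun hL z₀).trans (congrFun hhf z₀).symm)
    exact ⟨g, lift_unique hh (hsmul g).1 (hhf.trans (hsmul g).2.symm) z₀ hg.symm⟩
  · rintro ⟨g, rfl⟩
    exact hsmul g

theorem uniformContinuous_iff_continuous_of_lift (w : UniformSpace Z)
    (hwt : w.toTopologicalSpace = ‹TopologicalSpace Z›) (hw : IsUniformlyLocallyConnected w)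
    {f : Z → X} (hf : UniformContinuous[w, compactUniformity X] f)
    {h : Z → CompactUniversalCover X x₀} (hhf : proj ∘ h = f) :
    UniformContinuous[w, compactUniformity (CompactUniversalCover X x₀)] h ↔ Continuous h := by
  subst hwt
  constructor
  · intro hu
    exact @UniformContinuous.continuous _ _ w (compactUniformity _) h hu
  · intro hc
    refine uniformContinuous_of_coord w fun i => ?_
    let _ : UniformSpace X := compactUniformity X
    let _ : UniformSpace i.carrier := compactUniformity i.carrier
    refine hw.uniformContinuous_lift i.isCoveringMap.continuous
      i.isCoveringMap.isLocalHomeomorph.finite_fiber ((continuous_coord i).comp hc) ?_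
    -- Each coordinate of `h` is a lift of `f` through `i.map`, so its image below is `f` itself.
    convert hf using 1
    rw [← hhf]
    exact funext fun z => map_coord (h z) i

end CompactUniversalCover

theorem theorem7
    {X : Type u} [TopologicalSpace X] [CompactSpace X] [ConnectedSpace X]
    [TopologicalSpace.MetrizableSpace X] (x₀ : X)
    {Z : Type v} [tZ : TopologicalSpace Z] (hZ : IsPoincareSpace Z) [SimplyConnectedSpace Z]
    (f : Z → X) (hf : Continuous f) :
    ∃ fL : Z → CompactUniversalCover X x₀,
      (UniformContinuous[fineUniformity Z, compactUniformity (CompactUniversalCover X x₀)] fL ∧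
        CompactUniversalCover.proj ∘ fL = f) ∧
      {h : Z → CompactUniversalCover X x₀ |
          UniformContinuous[fineUniformity Z, compactUniformity (CompactUniversalCover X x₀)] h ∧
          CompactUniversalCover.proj ∘ h = f} =
        {h | ∃ g : ProfiniteFundamentalGroup X x₀, h = fun z => g • fL z} ∧
      {h : Z → CompactUniversalCover X x₀ |
          Continuous h ∧ CompactUniversalCover.proj ∘ h = f} =
        {h | ∃ g : ProfiniteFundamentalGroup X x₀, h = fun z => g • fL z} ∧
      ∀ w : UniformSpace Z, w.toTopologicalSpace = tZ → IsUniformlyLocallyConnected w →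
        UniformContinuous[w, compactUniformity X] f →
        {h : Z → CompactUniversalCover X x₀ |
            UniformContinuous[w, compactUniformity (CompactUniversalCover X x₀)] h ∧
            CompactUniversalCover.proj ∘ h = f} =
          {h | ∃ g : ProfiniteFundamentalGroup X x₀, h = fun z => g • fL z} := by
  have := hZ.connected
  have := hZ.locallyPathConnected
  obtain ⟨fL, hc, hL⟩ := CompactUniversalCover.exists_lift (x₀ := x₀) hf
  have hset := CompactUniversalCover.setOf_continuous_lift_eq hc hL
  refine ⟨fL, ⟨uniformContinuous_fineUniformity_iff.mpr hc, hL⟩, ?_, hset, ?_⟩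
  · simp only [uniformContinuous_fineUniformity_iff, hset]
  · intro w hwt hw hfw
    rw [← hset]
    ext h
    exact and_congr_left fun hhf =>
      CompactUniversalCover.uniformContinuous_iff_continuous_of_lift w hwt hw hfw hhf
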